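/- Let $\mathcal H$ be a complex separable Hilbert space with algebra of bounded operators $\mathcal B(\mathcal H)$, and let $X$ be a set with a $\sigma$-algebra $\mathcal O(X)$ of subsets. A positive operator valued measure (POVM) on $X$ is a map $\mu:\mathcal O(X)\to\mathcal B(\mathcal H)$ such that $\mu(A)\ge 0$ for all $A\in\mathcal O(X)$ and such that $A\mapsto\langle h,\mu(A)k\rangle$ is a complex measure for all $h,k\in\mathcal H$. It is *normalized* if $\mu(X)=I_{\mathcal H}$, *commutative* if $\mu(A)\mu(B)=\mu(B)\mu(A)$ for all $A,B\in\mathcal O(X)$, and a *spectral measure* if it is normalized and every $\mu(A)$ is an orthogonal projection. A normalized POVM $\mu$ is *$C^*$-extreme* if, whenever $n\in\mathbb N$, $\mu_1,\dots,\mu_n$ are normalized POVMs on $X$ with values in $\mathcal B(\mathcal H)$ and $T_1,\dots,T_n\in\mathcal B(\mathcal H)$ are invertible with $\sum_{i=1}^n T_i^*T_i=I_{\mathcal H}$ and $\mu(A)=\sum_{i=1}^n T_i^*\mu_i(A)T_i$ for all $A\in\mathcal O(X)$, then for each $i$ there is a unitary $U_i\in\mathcal B(\mathcal H)$ with $\mu_i(A)=U_i^*\mu(A)U_i$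 for all $A\in\mathcal O(X)$. **Theorem.** Let $\mu:\mathcal O(X)\to\mathcal B(\mathcal H)$ be a commutative normalized POVM. Then $\mu$ is $C^*$-extreme if and only if it is a spectral measure. -/

import Mathlib

/-- A positive operator valued measure on the measurable space `X` with values in the bounded
operators on the Hilbert space `H`: every measurable set is sent to a positive operator, and for
all `h`, `k` the map `A ↦ ⟪h, μ(A) k⟫` is a complex measure on the measurable sets. The values on
non-measurable sets carry no meaning and are never used. -/
structure POVM (X : Type*) [MeasurableSpace X] (H : Type*) [NormedAddCommGroup H]
    [InnerProductSpace ℂ H] [CompleteSpace H] where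
  /-- The operator assigned to a set. -/
  toFun : Set X → (H →L[ℂ] H)
  isPositive : ∀ A : Set X, MeasurableSet A → (toFun A).IsPositive
  isComplexMeasure : ∀ h k : H, ∃ m : MeasureTheory.ComplexMeasure X,
    ∀ A : Set X, MeasurableSet A → m A = inner ℂ h (toFun A k)

namespace POVM

variable {X : Type*} [MeasurableSpace X] {H : Type*} [NormedAddCommGroup H]
  [InnerProductSpace ℂ H] [CompleteSpace H]

/-- `μ` is normalized: `μ(X) = I`. -/
def IsNormalized (μ : POVM X H) : Prop :=
  μ.toFun Set.univ = 1

/-- `μ` is projection valued: each `μ(A)` is an orthogonal projection. -/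
def IsPVM (μ : POVM X H) : Prop :=
  ∀ A : Set X, MeasurableSet A → IsStarProjection (μ.toFun A)

/-- `μ` is a spectral measure: projection valued and normalized. -/
def IsSpectral (μ : POVM X H) : Prop :=
  μ.IsPVM ∧ μ.IsNormalized

/-- `μ` has commutative range. -/
def IsCommutative (μ : POVM X H) : Prop :=
  ∀ A B : Set X, MeasurableSet A → MeasurableSet B → Commute (μ.toFun A) (μ.toFun B)

/-- `μ = ∑ i, T i ^* ν i (·) T i` is a `C^*`-convex combination of normalized POVMs `ν i`, with
coefficients satisfying `∑ i, T i ^* T i = I`. -/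
structure IsCStarConvexCombination (μ : POVM X H) {n : ℕ} (T : Fin n → (H →L[ℂ] H))
    (ν : Fin n → POVM X H) : Prop where
  normalized : ∀ i, (ν i).IsNormalized
  sum_coeff : ∑ i, star (T i) * T i = 1
  sum_eq : ∀ A : Set X, MeasurableSet A →
    μ.toFun A = ∑ i, star (T i) * (ν i).toFun A * T i

/-- A `C^*`-convex combination is proper if all its coefficients are invertible. -/
structure IsProperCStarConvexCombination (μ : POVM X H) {n : ℕ} (T : Fin n → (H →L[ℂ] H))
    (ν : Fin n → POVM X H) : Prop extends IsCStarConvexCombination μ T ν where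
  isUnit : ∀ i, IsUnit (T i)

/-- `ν` is unitarily equivalent to `μ`: `ν(·) = U^* μ(·) U` for some unitary `U`. -/
def UnitarilyEquivalent (ν μ : POVM X H) : Prop :=
  ∃ U ∈ unitary (H →L[ℂ] H), ∀ A : Set X, MeasurableSet A →
    ν.toFun A = star U * μ.toFun A * U

/-- `μ` is a `C^*`-extreme point of the set of normalized POVMs: it is normalized, and whenever it
is a proper `C^*`-convex combination of normalized POVMs `ν i`, each `ν i` is unitarily equivalent
to `μ`. -/
def IsCStarExtreme (μ : POVM X H) : Prop :=
  μ.IsNormalized ∧ ∀ (n : ℕ) (T : Fin n → (H →L[ℂ] H)) (ν : Fin n → POVM X H),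
    IsProperCStarConvexCombination μ T ν → ∀ i, UnitarilyEquivalent (ν i) μ

end POVM

/-!
If `μ = ∑ Tᵢ^* νᵢ Tᵢ` is spectral, then `Tᵢ^* νᵢ(A) Tᵢ` lies below the projection `μ(A)`, hence is
supported on its range. Applied to `A` and to its complement this gives `νᵢ(A) Tᵢ = Tᵢ μ(A)`, and
the unitary part of `Tᵢ` inherits the intertwining relation.

Conversely, let `μ` be `C^*`-extreme and let `μ(B)` commute with the range of `μ`. Let `p` be the
spectral projection of `μ(B)` for the interval `(1/2, 1]`. Then the map
`α(A) = μ(A ∩ B) p + μ(A ∩ Bᶜ) (1 - p)` and its complement `μ - α` are POVMs, and `α(X) ≥ 1/2`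
because `p` selects the larger of `μ(B)` and `μ(Bᶜ)`. By extremality
`α(X)^{-1/2} α(·) α(X)^{-1/2}` is unitarily equivalent to `μ`. Since `α(B) = α(X) p`, its value at
`B` is the projection `p`, so `μ(B)` is a projection.
-/

section CStarAlgebra

variable {A : Type*} [CStarAlgebra A] [PartialOrder A] [StarOrderedRing A]

theorem exists_unitary_intertwining_of_isUnit {t : A} (ht : IsUnit t) :
    ∃ u ∈ unitary A, ∀ a b : A, b * t = t * a → star b * t = t * star a → b * u = u * a := by
  have hpos : IsStrictlyPositive (star t * t) := ⟨star_mul_self_nonneg t, ht.star.mul ht⟩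
  set s := (star t * t) ^ (-(1 / 2) : ℝ)
  have hs : star s = s := (IsSelfAdjoint.of_nonneg CFC.rpow_nonneg).star_eq
  have hu : IsUnit (t * s) := ht.mul (hpos.isUnit.cfcRpow _)
  refine ⟨t * s, hu.mem_unitary_of_star_mul_self ?_, fun a b hab hab' => ?_⟩
  · calc star (t * s) * (t * s) = s * (star t * t) * s := by rw [star_mul, hs]; noncomm_ring
      _ = 1 := CFC.conjugate_rpow_neg_one_half _
  · have hat : star t * b = a * star t := by simpa using congrArg star hab'
    have hcomm : Commute (star t * t) a := by
      rw [commute_iff_eq, mul_assoc, ← hab, ← mul_assoc, hat, mul_assoc]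
    have hsa : Commute s a := hcomm.cfc_nnreal _
    rw [← mul_assoc, hab, mul_assoc, mul_assoc, hsa.eq]

end CStarAlgebra

section SupportProjection

variable {𝕜 H : Type*} [RCLike 𝕜] [NormedAddCommGroup H] [InnerProductSpace 𝕜 H] [CompleteSpace H]

/-- The support projection of an operator `S`, that is, the projection onto the orthogonal
complement of its kernel. -/
noncomputable def supportProjection (S : H →L[𝕜] H) : H →L[𝕜] H :=
  S.kerᗮ.starProjection

theorem isStarProjection_supportProjection (S : H →L[𝕜] H) :
    IsStarProjection (supportProjection S) :=
  isStarProjection_starProjection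

theorem supportProjection_mul_eq_zero_iff {S Y : H →L[𝕜] H} :
    supportProjection S * Y = 0 ↔ S * Y = 0 := by
  simp only [ContinuousLinearMap.ext_iff, mul_apply_eq_comp, zero_apply,
    supportProjection, Submodule.starProjection_apply_eq_zero_iff, Submodule.orthogonal_orthogonal,
    LinearMap.mem_ker, ContinuousLinearMap.coe_coe]

theorem mul_supportProjection (S : H →L[𝕜] H) : S * supportProjection S = S := by
  have h : S * (1 - supportProjection S) = 0 :=
    supportProjection_mul_eq_zero_iff.1 (isStarProjection_supportProjection S).mul_one_sub_self
  rw [mul_sub, mul_one, sub_eq_zero] at h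
  exact h.symm

theorem commute_supportProjection {S Y : H →L[𝕜] H} (hY : Commute S Y)
    (hY' : Commute S (star Y)) : Commute (supportProjection S) Y := by
  set p := supportProjection S
  have hp : star p = p := (isStarProjection_supportProjection S).isSelfAdjoint
  have key : ∀ Z, Commute S Z → p * Z = p * Z * p := by
    intro Z hZ
    have h : p * (Z * (1 - p)) = 0 := by
      rw [supportProjection_mul_eq_zero_iff, ← mul_assoc, hZ.eq, mul_assoc, mul_sub, mul_one,
        mul_supportProjection, sub_self, mul_zero]
    rwa [mul_sub, mul_one, mul_sub, sub_eq_zero, ← mul_assoc] at h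
  have hstar : Y * p = p * Y * p := by
    simpa [hp, mul_assoc] using congrArg star (key (star Y) hY')
  exact (key Y hY).trans hstar.symm

end SupportProjection

section PosPart

variable {H : Type*} [NormedAddCommGroup H] [InnerProductSpace ℂ H] [CompleteSpace H]

theorem mul_supportProjection_posPart {T : H →L[ℂ] H} (hT : IsSelfAdjoint T) :
    T * supportProjection T⁺ = T⁺ := by
  have hp := (isStarProjection_supportProjection T⁺).isSelfAdjoint
  have hn := IsSelfAdjoint.of_nonneg (CFC.negPart_nonneg T)
  have h : T⁻ * supportProjection T⁺ = 0 := by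
    simpa [hp.star_eq, hn.star_eq] using
      congrArg star (supportProjection_mul_eq_zero_iff.2 (CFC.posPart_mul_negPart T))
  calc T * supportProjection T⁺ = (T⁺ - T⁻) * supportProjection T⁺ := by
        rw [CFC.posPart_sub_negPart T hT]
    _ = T⁺ := by rw [sub_mul, mul_supportProjection, h, sub_zero]

theorem mul_one_sub_supportProjection_posPart {T : H →L[ℂ] H} (hT : IsSelfAdjoint T) :
    T * (1 - supportProjection T⁺) = -T⁻ := by
  rw [mul_sub, mul_one, mul_supportProjection_posPart hT, ← neg_sub, neg_inj, sub_eq_iff_eq_add',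
    ← sub_eq_iff_eq_add]
  exact CFC.posPart_sub_negPart T hT

end PosPart

namespace POVM

variable {X : Type*} [MeasurableSpace X] {H : Type*} [NormedAddCommGroup H]
  [InnerProductSpace ℂ H] [CompleteSpace H]

theorem nonneg (μ : POVM X H) {A : Set X} (hA : MeasurableSet A) : 0 ≤ μ.toFun A :=
  (ContinuousLinearMap.nonneg_iff_isPositive _).2 (μ.isPositive A hA)

theorem isSelfAdjoint (μ : POVM X H) {A : Set X} (hA : MeasurableSet A) :
    IsSelfAdjoint (μ.toFun A) :=
  (μ.isPositive A hA).isSelfAdjoint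

theorem toFun_inter_add_inter_compl (μ : POVM X H) {A B : Set X} (hA : MeasurableSet A)
    (hB : MeasurableSet B) : μ.toFun (A ∩ B) + μ.toFun (A ∩ Bᶜ) = μ.toFun A := by
  refine ContinuousLinearMap.ext fun k => ext_inner_left ℂ fun h => ?_
  obtain ⟨m, hm⟩ := μ.isComplexMeasure h k
  rw [add_apply, inner_add_right, ← hm _ (hA.inter hB),
    ← hm _ (hA.inter hB.compl), ← hm _ hA,
    ← m.of_add_of_sdiff (hA.inter hB) hA Set.inter_subset_left, Set.sdiff_self_inter,
    Set.sdiff_eq]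

theorem toFun_empty (μ : POVM X H) : μ.toFun ∅ = 0 := by
  simpa using μ.toFun_inter_add_inter_compl MeasurableSet.empty MeasurableSet.empty

theorem IsNormalized.toFun_compl {μ : POVM X H} (hμ : μ.IsNormalized) {A : Set X}
    (hA : MeasurableSet A) : μ.toFun Aᶜ = 1 - μ.toFun A := by
  rw [eq_sub_iff_add_eq', ← hμ]
  simpa using μ.toFun_inter_add_inter_compl MeasurableSet.univ hA

theorem IsSpectral.toFun_mul_coeff {μ : POVM X H} (hμ : μ.IsSpectral) {n : ℕ}
    {T : Fin n → (H →L[ℂ] H)} {ν : Fin n → POVM X H} (h : IsProperCStarConvexCombination μ T ν)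
    (i : Fin n) {A : Set X} (hA : MeasurableSet A) :
    (ν i).toFun A * T i = T i * μ.toFun A := by
  have supported (B : Set X) (hB : MeasurableSet B) :
      (ν i).toFun B * T i * μ.toFun B = (ν i).toFun B * T i := by
    have hconj_nonneg : ∀ j, 0 ≤ star (T j) * (ν j).toFun B * T j :=
      fun j => star_left_conjugate_nonneg ((ν j).nonneg hB) _
    have hle : star (T i) * (ν i).toFun B * T i ≤ μ.toFun B := by
      rw [h.sum_eq B hB]
      exact Finset.single_le_sum (f := fun j => star (T j) * (ν j).toFun B * T j)
        (fun j _ => hconj_nonneg j) (Finset.mem_univ i)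
    refine (h.isUnit i).star.mul_left_cancel ?_
    simpa only [mul_assoc] using
      ((hμ.1 B hB).mul_right_and_mul_left_of_nonneg_of_le (hconj_nonneg i) hle).1
  have hAc := supported Aᶜ hA.compl
  rw [(h.normalized i).toFun_compl hA, hμ.2.toFun_compl hA, mul_sub, mul_one, sub_eq_self,
    sub_mul, sub_mul, one_mul, sub_eq_zero, supported A hA] at hAc
  exact hAc.symm

theorem IsSpectral.isCStarExtreme {μ : POVM X H} (hμ : μ.IsSpectral) : μ.IsCStarExtreme := by
  refine ⟨hμ.2, fun n T ν h i => ?_⟩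
  obtain ⟨u, hu, hintertwine⟩ := exists_unitary_intertwining_of_isUnit (h.isUnit i)
  refine ⟨star u, Unitary.star_mem hu, fun A hA => ?_⟩
  have hT := hμ.toFun_mul_coeff h i hA
  have hνu : (ν i).toFun A * u = u * μ.toFun A :=
    hintertwine _ _ hT (by rwa [(μ.isSelfAdjoint hA).star_eq, ((ν i).isSelfAdjoint hA).star_eq])
  rw [star_star, ← hνu, mul_assoc, Unitary.mul_star_self_of_mem hu, mul_one]

instance : Add (POVM X H) where
  add μ ν :=
    { toFun A := μ.toFun A + ν.toFun A
      isPositive A hA := (μ.isPositive A hA).add (ν.isPositive A hA)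
      isComplexMeasure h k := by
        obtain ⟨m, hm⟩ := μ.isComplexMeasure h k
        obtain ⟨n, hn⟩ := ν.isComplexMeasure h k
        exact ⟨m + n, fun A hA => by simp [hm A hA, hn A hA]⟩ }

theorem toFun_add (μ ν : POVM X H) (A : Set X) : (μ + ν).toFun A = μ.toFun A + ν.toFun A := rfl

/-- The restriction `A ↦ μ(A ∩ B)` of `μ` to the measurable set `B`. -/
def restrict (μ : POVM X H) (B : Set X) (hB : MeasurableSet B) : POVM X H where
  toFun A := μ.toFun (A ∩ B)
  isPositive A hA := μ.isPositive _ (hA.inter hB)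
  isComplexMeasure h k := by
    obtain ⟨m, hm⟩ := μ.isComplexMeasure h k
    exact ⟨m.restrict B, fun A hA => by
      rw [MeasureTheory.VectorMeasure.restrict_apply _ hB hA, hm _ (hA.inter hB)]⟩

/-- The compression `A ↦ S^* μ(A) S` of `μ` by an arbitrary operator `S`. -/
noncomputable def conj (μ : POVM X H) (S : H →L[ℂ] H) : POVM X H where
  toFun A := star S * μ.toFun A * S
  isPositive A hA := by
    rw [← ContinuousLinearMap.nonneg_iff_isPositive]
    exact star_left_conjugate_nonneg (μ.nonneg hA) S
  isComplexMeasure h k := by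
    obtain ⟨m, hm⟩ := μ.isComplexMeasure (S h) (S k)
    exact ⟨m, fun A hA => by
      simp [hm A hA, ContinuousLinearMap.star_eq_adjoint,
        ContinuousLinearMap.adjoint_inner_right]⟩

theorem toFun_conj (μ : POVM X H) (S : H →L[ℂ] H) (A : Set X) :
    (μ.conj S).toFun A = star S * μ.toFun A * S := rfl

theorem toFun_conj_smul (μ : POVM X H) (c : ℝ) (S : H →L[ℂ] H) (A : Set X) :
    (μ.conj (c • S)).toFun A = c ^ 2 • (μ.conj S).toFun A := by
  simp [toFun_conj, smul_smul, sq]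

/-- The normalization `A ↦ ρ(X)^{-1/2} ρ(A) ρ(X)^{-1/2}` of `ρ`, meaningful if `ρ(X)` is
invertible. -/
noncomputable def normalize (ρ : POVM X H) : POVM X H :=
  ρ.conj (ρ.toFun Set.univ ^ (-(1 / 2) : ℝ))

theorem toFun_normalize_of_eq_mul {ρ : POVM X H} (hρ : IsStrictlyPositive (ρ.toFun Set.univ))
    {A : Set X} {p : H →L[ℂ] H} (hA : ρ.toFun A = ρ.toFun Set.univ * p)
    (hp : Commute (ρ.toFun Set.univ) p) : ρ.normalize.toFun A = p := by
  set r := ρ.toFun Set.univ ^ (-(1 / 2) : ℝ)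
  have hrp : Commute r p := hp.cfc_nnreal _
  have hrs : star r = r := (IsSelfAdjoint.of_nonneg CFC.rpow_nonneg).star_eq
  calc ρ.normalize.toFun A = r * ρ.toFun Set.univ * r * p := by
        rw [normalize, toFun_conj, hrs, hA, mul_assoc, mul_assoc, ← hrp.eq]; simp only [mul_assoc]
    _ = p := by rw [CFC.conjugate_rpow_neg_one_half _ hρ, one_mul]

theorem isNormalized_normalize {ρ : POVM X H} (hρ : IsStrictlyPositive (ρ.toFun Set.univ)) :
    ρ.normalize.IsNormalized :=
  toFun_normalize_of_eq_mul hρ (mul_one _).symm (Commute.one_right _)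

theorem toFun_conj_normalize {ρ : POVM X H} (hρ : IsStrictlyPositive (ρ.toFun Set.univ))
    (A : Set X) :
    (ρ.normalize.conj (ρ.toFun Set.univ ^ (1 / 2 : ℝ))).toFun A = ρ.toFun A := by
  have hl := CFC.rpow_mul_rpow_neg (1 / 2) hρ
  have hr := CFC.rpow_neg_mul_rpow (1 / 2) hρ
  have hstar (x : ℝ) : star (ρ.toFun Set.univ ^ x) = ρ.toFun Set.univ ^ x :=
    (IsSelfAdjoint.of_nonneg CFC.rpow_nonneg).star_eq
  rw [normalize, toFun_conj, toFun_conj, hstar, hstar, mul_assoc, mul_assoc, hr, mul_one,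
    ← mul_assoc, hl, one_mul]

theorem IsCStarExtreme.unitarilyEquivalent_of_eq_conj_add_of_isStrictlyPositive {μ ν τ : POVM X H}
    (hμ : μ.IsCStarExtreme) (hν : ν.IsNormalized) {T : H →L[ℂ] H} (hT : IsUnit T)
    (hτ : IsStrictlyPositive (τ.toFun Set.univ))
    (h : ∀ A, MeasurableSet A → μ.toFun A = (ν.conj T + τ).toFun A) :
    UnitarilyEquivalent ν μ := by
  have hsum : ∀ A, MeasurableSet A → μ.toFun A = star T * ν.toFun A * T +
      star (τ.toFun Set.univ ^ (1 / 2 : ℝ)) * τ.normalize.toFun A *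
        τ.toFun Set.univ ^ (1 / 2 : ℝ) :=
    fun A hA => by rw [h A hA, toFun_add, ← toFun_conj_normalize hτ A]; rfl
  refine hμ.2 2 ![T, τ.toFun Set.univ ^ (1 / 2 : ℝ)] ![ν, τ.normalize] ⟨⟨?_, ?_, ?_⟩, ?_⟩ 0
  · simpa [Fin.forall_fin_two] using ⟨hν, isNormalized_normalize hτ⟩
  · have huniv := hsum _ MeasurableSet.univ
    rw [hμ.1, hν, isNormalized_normalize hτ, mul_one, mul_one] at huniv
    simpa [Fin.sum_univ_two] using huniv.symm
  · simpa [Fin.sum_univ_two] using hsum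
  · simpa [Fin.forall_fin_two] using ⟨hT, hτ.isUnit.cfcRpow _ hτ.nonneg⟩

/-- Moving half of `ν.conj T` into the remainder makes the latter invertible. -/
theorem IsCStarExtreme.unitarilyEquivalent_of_eq_conj_add {μ ν τ : POVM X H}
    (hμ : μ.IsCStarExtreme) (hν : ν.IsNormalized) {T : H →L[ℂ] H} (hT : IsUnit T)
    (h : ∀ A, MeasurableSet A → μ.toFun A = (ν.conj T + τ).toFun A) :
    UnitarilyEquivalent ν μ := by
  set S := (√2)⁻¹ • T
  have hS : IsUnit S := hT.smul (Units.mk0 (√2)⁻¹ (by positivity))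
  have half (A : Set X) : (ν.conj S).toFun A = (1 / 2 : ℝ) • (ν.conj T).toFun A := by
    rw [toFun_conj_smul]; norm_num
  have hpos : IsStrictlyPositive ((ν.conj S + τ).toFun Set.univ) := by
    refine IsStrictlyPositive.add_nonneg ⟨(ν.conj S).nonneg MeasurableSet.univ, ?_⟩
      (τ.nonneg MeasurableSet.univ)
    rw [toFun_conj, hν, mul_one]
    exact hS.star.mul hS
  refine hμ.unitarilyEquivalent_of_eq_conj_add_of_isStrictlyPositive hν hS hpos fun A hA => ?_
  rw [h A hA, toFun_add, toFun_add, toFun_add, half]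
  module

/-- The pinching `A ↦ p^* μ(A ∩ B) p + (1 - p)^* μ(A ∩ Bᶜ) (1 - p)` of `μ`, which for a projection
`p` keeps only the part of `μ` on `B` over the range of `p` and the part on `Bᶜ` over the orthogonal
complement of that range. -/
noncomputable def pinch (μ : POVM X H) (B : Set X) (hB : MeasurableSet B) (p : H →L[ℂ] H) :
    POVM X H :=
  (μ.restrict B hB).conj p + (μ.restrict Bᶜ hB.compl).conj (1 - p)

theorem toFun_pinch (μ : POVM X H) {A B : Set X} (hA : MeasurableSet A) (hB : MeasurableSet B)
    {p : H →L[ℂ] H} (hp : IsStarProjection p)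
    (hcomm : ∀ A, MeasurableSet A → Commute p (μ.toFun A)) :
    (μ.pinch B hB p).toFun A = μ.toFun (A ∩ B) * p + μ.toFun (A ∩ Bᶜ) * (1 - p) := by
  have compress {q : H →L[ℂ] H} (hq : IsStarProjection q) {D : H →L[ℂ] H} (hqD : Commute q D) :
      star q * D * q = D * q := by
    rw [hq.isSelfAdjoint.star_eq, hqD.eq, mul_assoc, hq.isIdempotentElem.eq]
  have hcomm' : Commute (1 - p) (μ.toFun (A ∩ Bᶜ)) :=
    (Commute.one_left _).sub_left (hcomm _ (hA.inter hB.compl))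
  exact congrArg₂ (· + ·) (compress hp (hcomm _ (hA.inter hB))) (compress hp.one_sub hcomm')

theorem toFun_pinch_add_pinch_one_sub (μ : POVM X H) {A B : Set X} (hA : MeasurableSet A)
    (hB : MeasurableSet B) {p : H →L[ℂ] H} (hp : IsStarProjection p)
    (hcomm : ∀ A, MeasurableSet A → Commute p (μ.toFun A)) :
    (μ.pinch B hB p + μ.pinch B hB (1 - p)).toFun A = μ.toFun A := by
  have hcomm' : ∀ A, MeasurableSet A → Commute (1 - p) (μ.toFun A) :=
    fun A hA => (Commute.one_left _).sub_left (hcomm A hA)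
  rw [toFun_add, μ.toFun_pinch hA hB hp hcomm, μ.toFun_pinch hA hB hp.one_sub hcomm',
    ← μ.toFun_inter_add_inter_compl hA hB]
  noncomm_ring

theorem toFun_pinch_univ (μ : POVM X H) {B : Set X} (hB : MeasurableSet B) {p : H →L[ℂ] H}
    (hp : IsStarProjection p) (hcomm : ∀ A, MeasurableSet A → Commute p (μ.toFun A)) :
    (μ.pinch B hB p).toFun Set.univ = μ.toFun B * p + μ.toFun Bᶜ * (1 - p) := by
  simpa using μ.toFun_pinch MeasurableSet.univ hB hp hcomm

theorem toFun_pinch_self (μ : POVM X H) {B : Set X} (hB : MeasurableSet B) {p : H →L[ℂ] H}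
    (hp : IsStarProjection p) (hcomm : ∀ A, MeasurableSet A → Commute p (μ.toFun A)) :
    (μ.pinch B hB p).toFun B = (μ.pinch B hB p).toFun Set.univ * p := by
  rw [μ.toFun_pinch hB hB hp hcomm, μ.toFun_pinch_univ hB hp hcomm, Set.inter_self,
    Set.inter_compl_self, toFun_empty, zero_mul, add_zero, add_mul, mul_assoc, mul_assoc,
    hp.isIdempotentElem.eq, hp.one_sub_mul_self, mul_zero, add_zero]

theorem commute_toFun_pinch_univ (μ : POVM X H) {B : Set X} (hB : MeasurableSet B) {p : H →L[ℂ] H}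
    (hp : IsStarProjection p) (hcomm : ∀ A, MeasurableSet A → Commute p (μ.toFun A)) :
    Commute ((μ.pinch B hB p).toFun Set.univ) p := by
  rw [μ.toFun_pinch_univ hB hp hcomm]
  exact ((hcomm B hB).symm.mul_left (Commute.refl p)).add_left
    ((hcomm _ hB.compl).symm.mul_left ((Commute.one_left p).sub_left (Commute.refl p)))

theorem isStrictlyPositive_toFun_pinch_univ {μ : POVM X H} (hμ : μ.IsNormalized) {B : Set X}
    (hB : MeasurableSet B) {p : H →L[ℂ] H} (hp : IsStarProjection p)
    (hcomm : ∀ A, MeasurableSet A → Commute p (μ.toFun A))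
    (hle : μ.toFun Bᶜ * p ≤ μ.toFun B * p)
    (hge : μ.toFun B * (1 - p) ≤ μ.toFun Bᶜ * (1 - p)) :
    IsStrictlyPositive ((μ.pinch B hB p).toFun Set.univ) := by
  set a := (μ.pinch B hB p).toFun Set.univ
  have ha : a = μ.toFun B * p + μ.toFun Bᶜ * (1 - p) := μ.toFun_pinch_univ hB hp hcomm
  have hone : 1 ≤ (2 : ℝ) • a :=
    calc (1 : H →L[ℂ] H) = μ.toFun B * p + μ.toFun Bᶜ * p +
          (μ.toFun B * (1 - p) + μ.toFun Bᶜ * (1 - p)) := by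
          rw [hμ.toFun_compl hB]; noncomm_ring
      _ ≤ μ.toFun B * p + μ.toFun B * p + (μ.toFun Bᶜ * (1 - p) + μ.toFun Bᶜ * (1 - p)) := by
          gcongr
      _ = (2 : ℝ) • a := by rw [ha]; module
  have hpos : IsStrictlyPositive ((2 : ℝ) • a) := isStrictlyPositive_one.of_le hone
  simpa [smul_smul] using hpos.smul (one_half_pos (α := ℝ))

theorem UnitarilyEquivalent.isStarProjection_toFun {ν μ : POVM X H} (h : UnitarilyEquivalent ν μ)
    {A : Set X} (hA : MeasurableSet A) (hν : IsStarProjection (ν.toFun A)) :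
    IsStarProjection (μ.toFun A) := by
  obtain ⟨U, hU, hνμ⟩ := h
  set φ := Unitary.conjStarAlgAut ℂ (H →L[ℂ] H) ⟨U, hU⟩
  have hφ : μ.toFun A = φ (ν.toFun A) := by
    rw [← φ.symm_apply_eq, hνμ A hA, Unitary.conjStarAlgAut_symm_apply]
  rw [hφ]
  exact ⟨hν.isIdempotentElem.map φ, hν.isSelfAdjoint.map φ⟩

theorem IsCStarExtreme.isStarProjection_toFun_of_commute {μ : POVM X H} (hμ : μ.IsCStarExtreme)
    {B : Set X} (hB : MeasurableSet B)
    (hcomm : ∀ A, MeasurableSet A → Commute (μ.toFun B) (μ.toFun A)) :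
    IsStarProjection (μ.toFun B) := by
  set T := μ.toFun B - μ.toFun Bᶜ with hT
  have hTs : IsSelfAdjoint T := (μ.isSelfAdjoint hB).sub (μ.isSelfAdjoint hB.compl)
  set p := supportProjection T⁺
  have hp : IsStarProjection p := isStarProjection_supportProjection T⁺
  have hpμ : ∀ A, MeasurableSet A → Commute p (μ.toFun A) := by
    intro A hA
    have hTA : Commute T (μ.toFun A) := by
      rw [hT, hμ.1.toFun_compl hB]
      exact (hcomm A hA).sub_left ((Commute.one_left _).sub_left (hcomm A hA))
    have hposA : Commute T⁺ (μ.toFun A) := hTA.cfcₙ_real _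
    exact commute_supportProjection hposA (by rwa [(μ.isSelfAdjoint hA).star_eq])
  set α := μ.pinch B hB p
  have hα : IsStrictlyPositive (α.toFun Set.univ) := by
    refine isStrictlyPositive_toFun_pinch_univ hμ.1 hB hp hpμ ?_ ?_
    · rw [← sub_nonneg, ← sub_mul, mul_supportProjection_posPart hTs]
      exact CFC.posPart_nonneg T
    · rw [← sub_nonpos, ← sub_mul, mul_one_sub_supportProjection_posPart hTs]
      exact neg_nonpos.2 (CFC.negPart_nonneg T)
  have hequiv : UnitarilyEquivalent α.normalize μ :=
    hμ.unitarilyEquivalent_of_eq_conj_add (τ := μ.pinch B hB (1 - p)) (isNormalized_normalize hα)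
      (hα.isUnit.cfcRpow (1 / 2) hα.nonneg) fun A hA => by
        rw [toFun_add, toFun_conj_normalize hα, ← toFun_add,
          μ.toFun_pinch_add_pinch_one_sub hA hB hp hpμ]
  refine hequiv.isStarProjection_toFun hB ?_
  rwa [toFun_normalize_of_eq_mul hα (μ.toFun_pinch_self hB hp hpμ)
    (μ.commute_toFun_pinch_univ hB hp hpμ)]

end POVM

theorem mainTheorem4_general {X : Type*} [MeasurableSpace X] {H : Type*} [NormedAddCommGroup H]
    [InnerProductSpace ℂ H] [CompleteSpace H] (μ : POVM X H) (hcomm : μ.IsCommutative) :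
    μ.IsCStarExtreme ↔ μ.IsSpectral :=
  ⟨fun h => ⟨fun B hB => h.isStarProjection_toFun_of_commute hB fun A hA => hcomm B A hB hA, h.1⟩,
    fun h => h.isCStarExtreme⟩

theorem mainTheorem4 {X : Type*} [MeasurableSpace X] {H : Type*} [NormedAddCommGroup H]
    [InnerProductSpace ℂ H] [CompleteSpace H] [TopologicalSpace.SeparableSpace H]
    (μ : POVM X H) (hnorm : μ.IsNormalized) (hcomm : μ.IsCommutative) :
    μ.IsCStarExtreme ↔ μ.IsSpectral :=
  mainTheorem4_general μ hcomm
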